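/- Let $n\ge 1$ and let $\beta\ge n+1$ be real. For a probability density $f$ on $\mathbb R^n$ write $h(f)=-\int_{\mathbb R^n} f\log f\,dx$ and let $\|f\|_\infty$ be the essential supremum of $f$ with respect to Lebesgue measure; if a random vector $X$ has density $f$, put $h(X)=h(f)$. For $a>0$ the $n$-dimensional Pareto density is $$f_{\beta,a}(x)=\frac{1}{Z_n(\beta,a)}\,(a+x_1+\dots+x_n)^{-\beta}\quad(x_1,\dots,x_n>0),\qquad Z_n(\beta,a)=\int_{(0,\infty)^n}(a+x_1+\dots+x_n)^{-\beta}\,dx,$$ and $f_{\beta,a}(x)=0$ for all other $x$. Let $X$ be a random vector in $\mathbb R^n$ with a density $f$ such that $f=\varphi^{-\beta}$ on an open convex set $\Omega\subseteq\mathbb R^n$, where $\varphi$ is a positive convex function on $\Omega$, and $f=0$ outside $\Omega$. Then $0<\|f\|_\infty<\infty$, the integral defining $h(X)$ converges absolutely, and among all such $X$ with a given value of $\|f\|_\infty$ the entropy is maximal for the Pareto distribution: $h(X)\le h(f_{\beta,a})$ whenever $a>0$ and $\|f_{\beta,a}\|_\infty=\|f\|_\infty$. Here each $f_{\beta,a}$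 is itself a probability density of this form (with the same $\beta$), and for every $M>0$ there is $a>0$ with $\|f_{\beta,a}\|_\infty=M$. Equivalently, $$h(X)+\log\|f\|_\infty\;\le\;\beta\sum_{i=1}^n\frac{1}{\beta-i},$$ where the right-hand side equals $h(f_{\beta,a})+\log\|f_{\beta,a}\|_\infty$ for every $a>0$ (with $0<\|f_{\beta,a}\|_\infty<\infty$ and $h(f_{\beta,a})$ given by an absolutely convergent integral). -/

import Mathlib

open MeasureTheory

noncomputable section

namespace ConvexEntropy

/-- The space `ℝⁿ`. -/
abbrev Vec (n : ℕ) : Type := EuclideanSpace ℝ (Fin n)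

/-- The function `f` is a probability density with respect to Lebesgue measure on `ℝⁿ`. -/
structure IsProbDensity {n : ℕ} (f : Vec n → ℝ) : Prop where
  measurable : Measurable f
  nonneg : ∀ x, 0 ≤ f x
  lintegral_eq_one : ∫⁻ x, ENNReal.ofReal (f x) = 1

/-- The random vector `X` in `ℝⁿ` has density `f`: its law is `f(x) dx`. -/
structure HasDensity {n : ℕ} {S : Type*} [MeasurableSpace S] (X : S → Vec n) (P : Measure S)
    (f : Vec n → ℝ) : Prop where
  aemeasurable : AEMeasurable X P
  isProbDensity : IsProbDensity f
  map_eq : P.map X = volume.withDensity (fun x => ENNReal.ofReal (f x))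

/-- The function `f` has the form `f = φ ^ (-β)` on an open convex set `Ω ⊆ ℝⁿ`, where `φ` is
positive and convex on `Ω`, and `f = 0` outside of `Ω`. -/
def IsConvexForm {n : ℕ} (β : ℝ) (f : Vec n → ℝ) : Prop :=
  ∃ (Ω : Set (Vec n)) (φ : Vec n → ℝ), IsOpen Ω ∧ Convex ℝ Ω ∧ ConvexOn ℝ Ω φ ∧
    (∀ x ∈ Ω, 0 < φ x) ∧ (∀ x ∈ Ω, f x = φ x ^ (-β)) ∧ (∀ x ∉ Ω, f x = 0)

/-- The entropy functional `h(f) = -∫ f log f`. -/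
def entropyFun {n : ℕ} (f : Vec n → ℝ) : ℝ :=
  -∫ x, f x * Real.log (f x)

/-- The integral that defines `h(f)` exists and is finite. -/
def EntropyFinite {n : ℕ} (f : Vec n → ℝ) : Prop :=
  Integrable (fun x => f x * Real.log (f x))

/-- The entropy `h(X)` of a random vector `X` in `ℝⁿ`, i.e. of its density. -/
def entropy {n : ℕ} {S : Type*} [MeasurableSpace S] (X : S → Vec n) (P : Measure S) : ℝ :=
  entropyFun (fun x => (pdf X P volume x).toReal)

/-- The norm `‖f‖_∞`, the essential supremum of `|f|` with respect to Lebesgue measure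
(meaningful for essentially bounded `f`). -/
def supNorm {n : ℕ} (f : Vec n → ℝ) : ℝ :=
  (eLpNorm f ⊤ volume).toReal

/-- The open positive orthant of `ℝⁿ`. -/
def posOrthant (n : ℕ) : Set (Vec n) := {x | ∀ i, 0 < x i}

/-- The normalizing factor `Z_n(β, a)`. -/
def paretoZ (n : ℕ) (β a : ℝ) : ℝ :=
  ∫ x in posOrthant n, (a + ∑ i, x i) ^ (-β)

/-- The density `f_{β,a}` of the `n`-dimensional Pareto distribution. -/
def pareto (n : ℕ) (β a : ℝ) : Vec n → ℝ :=
  (posOrthant n).indicator (fun x => 1 / paretoZ n β a * (a + ∑ i, x i) ^ (-β))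

end ConvexEntropy

end

/-!
# The entropy of densities `φ ^ (-β)` is maximized by the Pareto distribution

Put `m = inf φ` and `c = ∑ 1 / (β - i)`. Then `‖f‖_∞ = m ^ (-β)` and
`h(f) + log ‖f‖_∞ = β ∫ f log (φ / m)`, so after replacing `φ` by `φ / m` the entropy bound says
that `∫ (c - log φ) φ ^ (-β) ≥ 0` for a convex `φ` with infimum `1`. The Pareto function
`φ₀ = 1 + ∑ xᵢ` on the positive orthant gives equality, by integrating out one variable at a time
(`lintegral_pi_pos_rpow_mul_log`).

For general `φ`, contracting sublevel sets towards a near-minimizer of `φ` shows that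
`|{φ < t}| / (t - 1) ^ n` is nonincreasing (`measure_sublevel_ratio`); no Brunn-Minkowski inequality
is needed. For `φ₀` this ratio is constant. Hence, if Lebesgue measure on the orthant is multiplied
by the constant for which `|{φ < t₀}|` and `|{φ₀ < t₀}|` agree, `φ` has the larger sublevel sets
below `t₀` and the smaller ones above `t₀`. The function `w(t) = (c - log t) t ^ (-β)` decreases up
to `t₀ = exp (c + 1 / β)` and increases afterwards, so it is a difference `lowPart - highPart` of
nonincreasing functions, the first vanishing beyond `t₀` and the second constant up to `t₀`. By the
layer-cake formula (`lintegral_comp_antitone_le`) the integral of `lowPart` is smallest, and that of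
`highPart` is largest, for `φ₀`, where the two are equal. This gives `∫ w(φ) ≥ 0`
(`lintegral_rpow_neg_mul_log_le`).

The same contraction, with Markov's inequality for `φ ^ (-β)` and `β > n`, shows that `m > 0`
(`ConvexRep.exists_isGLB`).
-/

noncomputable section

open Filter Topology
open scoped ENNReal

namespace ConvexEntropy

/-! ### Sublevel sets of convex functions -/

section Sublevel

variable {E : Type*} [NormedAddCommGroup E] [NormedSpace ℝ E] [MeasurableSpace E] [BorelSpace E]
  [FiniteDimensional ℝ E] {Ω : Set E} {φ : E → ℝ}

/-- Contracting a sublevel set of a convex function towards a point `x₀` of its domain, by the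
factor `r`, lands in a lower sublevel set. -/
lemma measure_sublevel_homothety (μ : Measure E) [μ.IsAddHaarMeasure] (hφ : ConvexOn ℝ Ω φ)
    {x₀ : E} (hx₀ : x₀ ∈ Ω) {r : ℝ} (hr0 : 0 < r) (hr1 : r ≤ 1) (t : ℝ) :
    ENNReal.ofReal (r ^ Module.finrank ℝ E) * μ {x | x ∈ Ω ∧ φ x < t}
      ≤ μ {x | x ∈ Ω ∧ φ x < r * t + (1 - r) * φ x₀} := by
  have h := Measure.addHaar_image_homothety μ x₀ r {x | x ∈ Ω ∧ φ x < t}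
  rw [abs_of_pos (pow_pos hr0 _)] at h
  rw [← h]
  refine measure_mono ?_
  rintro _ ⟨x, ⟨hx, hxt⟩, rfl⟩
  have e : AffineMap.homothety x₀ r x = r • x + (1 - r) • x₀ := by
    rw [AffineMap.homothety_apply, vsub_eq_sub, vadd_eq_add]
    module
  rw [e]
  refine ⟨hφ.1 hx hx₀ hr0.le (by linarith) (by ring), ?_⟩
  have := hφ.2 hx hx₀ hr0.le (by linarith : 0 ≤ 1 - r) (by ring)
  simp only [smul_eq_mul] at this
  nlinarith

/-- If `m = inf φ`, then `t ↦ μ {φ < t} / (t - m) ^ n` is nonincreasing on `(m, ∞)`. The infimum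
need not be attained, so the sets are contracted towards near-minimizers of `φ`. -/
lemma measure_sublevel_ratio (μ : Measure E) [μ.IsAddHaarMeasure] (hφ : ConvexOn ℝ Ω φ) {m : ℝ}
    (hm : IsGLB (φ '' Ω) m) {s t : ℝ} (hs : m < s) (hst : s ≤ t) :
    ENNReal.ofReal (((s - m) / (t - m)) ^ Module.finrank ℝ E) * μ {x | x ∈ Ω ∧ φ x < t}
      ≤ μ {x | x ∈ Ω ∧ φ x < s} := by
  have hlim : Tendsto (fun m' : ℝ => ENNReal.ofReal (((s - m') / (t - m')) ^ Module.finrank ℝ E) *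
      μ {x | x ∈ Ω ∧ φ x < t}) (𝓝[>] m)
      (𝓝 (ENNReal.ofReal (((s - m) / (t - m)) ^ Module.finrank ℝ E) *
        μ {x | x ∈ Ω ∧ φ x < t})) := by
    refine ENNReal.Tendsto.mul_const ?_ (Or.inl ?_)
    · refine (ENNReal.continuous_ofReal.tendsto _).comp (tendsto_nhdsWithin_of_tendsto_nhds ?_)
      have : ContinuousAt (fun m' : ℝ => ((s - m') / (t - m')) ^ Module.finrank ℝ E) m :=
        ((continuousAt_const.sub continuousAt_id).div (continuousAt_const.sub continuousAt_id)
          (by simp; linarith)).pow _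
      exact this
    · have : 0 < (s - m) / (t - m) := div_pos (by linarith) (by linarith)
      simp only [ne_eq, ENNReal.ofReal_eq_zero, not_le]
      positivity
  refine le_of_tendsto hlim ?_
  filter_upwards [Ioo_mem_nhdsGT hs] with m' hm'
  obtain ⟨_, ⟨x₀, hx₀, rfl⟩, -, hlt⟩ := hm.exists_between hm'.1
  have h1 : 0 < t - m' := by linarith [hm'.2]
  have hr0 : 0 < (s - m') / (t - m') := div_pos (by linarith [hm'.2]) h1
  have hr1 : (s - m') / (t - m') ≤ 1 := by rw [div_le_one h1]; linarith
  refine (measure_sublevel_homothety μ hφ hx₀ hr0 hr1 t).trans (measure_mono ?_)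
  rintro x ⟨hx, hxt⟩
  refine ⟨hx, hxt.trans_le ?_⟩
  have h2 : (s - m') / (t - m') * (t - m') = s - m' := div_mul_cancel₀ _ h1.ne'
  nlinarith

end Sublevel

/-! ### Comparison of integrals through level sets -/

/-- Layer-cake comparison: the integral of a nonincreasing function `G` of `u` grows with the
measures of the sublevel sets of `u`, and only the levels where `G` is positive matter. -/
lemma lintegral_comp_antitone_le {α α' : Type*} [MeasurableSpace α] [MeasurableSpace α']
    {μ : Measure α} {ν : Measure α'} {u : α → ℝ} {v : α' → ℝ} (hu : AEMeasurable u μ)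
    (hv : AEMeasurable v ν) {G : ℝ → ℝ} (hG : Antitone G) (hGc : Continuous G)
    (hG0 : ∀ t, 0 ≤ G t) (h : ∀ q, 0 < G q → μ {x | u x < q} ≤ ν {x | v x < q}) :
    ∫⁻ x, ENNReal.ofReal (G (u x)) ∂μ ≤ ∫⁻ x, ENNReal.ofReal (G (v x)) ∂ν := by
  rw [lintegral_eq_lintegral_meas_lt μ (Eventually.of_forall fun x => hG0 _)
      (hGc.measurable.comp_aemeasurable hu),
    lintegral_eq_lintegral_meas_lt ν (Eventually.of_forall fun x => hG0 _)
      (hGc.measurable.comp_aemeasurable hv)]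
  refine setLIntegral_mono' measurableSet_Ioi fun s hs => ?_
  -- the superlevel set `{G > s}` is an open half-line, a union of half-lines with rational ends
  have key : ∀ y : ℝ, s < G y ↔ ∃ q : {q : ℚ // s < G q}, y < (q : ℚ) := by
    intro y
    constructor
    · intro hy
      obtain ⟨ε, hε, hball⟩ := Metric.isOpen_iff.1 (isOpen_lt continuous_const hGc) y hy
      obtain ⟨q, hq1, hq2⟩ := exists_rat_btwn (by linarith : y < y + ε)
      refine ⟨⟨q, ?_⟩, hq1⟩
      apply hball
      rw [Metric.mem_ball, Real.dist_eq, abs_lt]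
      constructor <;> linarith
    · rintro ⟨q, hq⟩
      exact q.2.trans_le (hG hq.le)
  have h1 : {x | s < G (u x)} = ⋃ q : {q : ℚ // s < G q}, {x | u x < (q : ℚ)} := by
    ext x; simp only [Set.mem_ofPred_eq, Set.mem_iUnion]; exact key _
  have h2 : {x | s < G (v x)} = ⋃ q : {q : ℚ // s < G q}, {x | v x < (q : ℚ)} := by
    ext x; simp only [Set.mem_ofPred_eq, Set.mem_iUnion]; exact key _
  have d1 : Directed (· ⊆ ·) (fun q : {q : ℚ // s < G q} => {x | u x < ((q : ℚ) : ℝ)}) :=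
    Monotone.directed_le fun a b hab x hx =>
      lt_of_lt_of_le hx (by exact_mod_cast hab : ((a : ℚ) : ℝ) ≤ (b : ℚ))
  have d2 : Directed (· ⊆ ·) (fun q : {q : ℚ // s < G q} => {x | v x < ((q : ℚ) : ℝ)}) :=
    Monotone.directed_le fun a b hab x hx =>
      lt_of_lt_of_le hx (by exact_mod_cast hab : ((a : ℚ) : ℝ) ≤ (b : ℚ))
  rw [h1, h2, d1.measure_iUnion, d2.measure_iUnion]
  exact iSup_mono fun q => h _ (lt_trans hs q.2)

/-! ### The Pareto integral -/

/-- The one-dimensional step: integrating out one variable raises the exponent by one and keeps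
the form `power * (affine function of the logarithm)`. The base point `a₀ ≤ a` makes the
logarithm nonnegative, so that the formula can be stated for lower integrals. -/
lemma lintegral_Ioi_rpow_mul_log {a₀ a q e d : ℝ} (ha₀ : 0 < a₀) (ha : a₀ ≤ a) (hq : 1 < q)
    (he : 0 ≤ e) (hd : 0 ≤ d) :
    ∫⁻ y in Set.Ioi (0 : ℝ), ENNReal.ofReal ((a + y) ^ (-q) * (e * Real.log ((a + y) / a₀) + d))
      = ENNReal.ofReal (a ^ (1 - q) / (q - 1) *
          (e * Real.log (a / a₀) + (d + e * (1 / (q - 1))))) := by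
  have ha' : 0 < a := ha₀.trans_le ha
  have hq' : 0 < q - 1 := by linarith
  set g : ℝ → ℝ := fun y => -((a + y) ^ (1 - q) / (q - 1) *
    (e * Real.log ((a + y) / a₀) + (d + e * (1 / (q - 1))))) with hg
  set g' : ℝ → ℝ := fun y => (a + y) ^ (-q) * (e * Real.log ((a + y) / a₀) + d) with hg'
  have hderiv : ∀ y ∈ Set.Ici (0 : ℝ), HasDerivAt g (g' y) y := by
    intro y hy
    have hy0 : 0 < a + y := by have : (0 : ℝ) ≤ y := hy; linarith
    have h1 : HasDerivAt (fun y : ℝ => a + y) 1 y := (hasDerivAt_id y).const_add a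
    have h2 := h1.rpow_const (p := 1 - q) (Or.inl hy0.ne')
    have h3 := (h1.div_const a₀).log (by positivity)
    have h4 := ((h2.div_const (q - 1)).mul ((h3.const_mul e).add_const (d + e * (1 / (q - 1))))).neg
    refine h4.congr_deriv ?_
    simp only [hg']
    have e1 : (a + y) ^ (1 - q) = (a + y) ^ (-q) * (a + y) := by
      rw [show 1 - q = -q + 1 by ring, Real.rpow_add hy0, Real.rpow_one]
    have e2 : (1 - q - 1 : ℝ) = -q := by ring
    rw [e1, e2]
    field_simp
    ring
  have hnn : ∀ y ∈ Set.Ioi (0 : ℝ), 0 ≤ g' y := by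
    intro y hy
    have hy0 : (0 : ℝ) < y := hy
    have h1 : 0 ≤ Real.log ((a + y) / a₀) := Real.log_nonneg (by rw [le_div_iff₀ ha₀]; linarith)
    have : 0 < a + y := by linarith
    simp only [hg']
    positivity
  have hlim : Tendsto g atTop (𝓝 0) := by
    have hay : Tendsto (fun y : ℝ => a + y) atTop atTop := tendsto_atTop_add_const_left _ _ tendsto_id
    have l1 : Tendsto (fun t : ℝ => t ^ (1 - q)) atTop (𝓝 0) := by
      have := tendsto_rpow_neg_atTop hq'
      simpa using this
    have l2 : Tendsto (fun t : ℝ => Real.log t * t ^ (1 - q)) atTop (𝓝 0) := by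
      have := (isLittleO_log_rpow_atTop hq').tendsto_div_nhds_zero
      refine this.congr' ?_
      filter_upwards [eventually_gt_atTop 0] with t ht
      rw [show 1 - q = -(q - 1) by ring, Real.rpow_neg ht.le, div_eq_mul_inv]
    have l3 : Tendsto (fun t : ℝ => -((e / (q - 1)) * (Real.log t * t ^ (1 - q)) +
        ((d + e * (1 / (q - 1)) - e * Real.log a₀) / (q - 1)) * t ^ (1 - q))) atTop (𝓝 0) := by
      simpa using ((l2.const_mul (e / (q - 1))).add
        (l1.const_mul ((d + e * (1 / (q - 1)) - e * Real.log a₀) / (q - 1)))).neg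
    refine (l3.comp hay).congr' ?_
    filter_upwards [eventually_gt_atTop 0] with y hy
    have : 0 < a + y := by linarith
    simp only [hg, Function.comp, Real.log_div this.ne' ha₀.ne']
    ring
  rw [← ofReal_integral_eq_lintegral_ofReal (integrableOn_Ioi_deriv_of_nonneg' hderiv hnn hlim)
    ((ae_restrict_iff' measurableSet_Ioi).2 (Eventually.of_forall hnn)),
    integral_Ioi_of_hasDerivAt_of_nonneg' hderiv hnn hlim]
  simp [hg]

/-- Integrating a function of `a + ∑ xᵢ` over the positive orthant, one variable at a time. -/
lemma lintegral_pi_pos_succ (n : ℕ) {F : ℝ → ℝ≥0∞} (hF : Measurable F) (a : ℝ) :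
    ∫⁻ x in {x : Fin (n + 1) → ℝ | ∀ i, 0 < x i}, F (a + ∑ i, x i)
      = ∫⁻ y in Set.Ioi (0 : ℝ), ∫⁻ x in {x : Fin n → ℝ | ∀ i, 0 < x i}, F (a + y + ∑ i, x i) := by
  have hmeas : ∀ k : ℕ, MeasurableSet {x : Fin k → ℝ | ∀ i, 0 < x i} := by
    intro k
    rw [Set.ofPred_forall]
    exact MeasurableSet.iInter fun i => measurableSet_lt measurable_const (measurable_pi_apply i)
  have hmp := (volume_preserving_piFinSuccAbove (fun _ : Fin (n + 1) => ℝ) 0)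
  have hpre : {x : Fin (n + 1) → ℝ | ∀ i, 0 < x i} =
      (MeasurableEquiv.piFinSuccAbove (fun _ : Fin (n + 1) => ℝ) 0) ⁻¹'
        (Set.Ioi (0 : ℝ) ×ˢ {x : Fin n → ℝ | ∀ i, 0 < x i}) := by
    ext x
    simp [MeasurableEquiv.piFinSuccAbove, Fin.forall_fin_succ, Fin.tail]
  have hcomp := hmp.setLIntegral_comp_preimage
    (s := Set.Ioi (0 : ℝ) ×ˢ {x : Fin n → ℝ | ∀ i, 0 < x i}) (measurableSet_Ioi.prod (hmeas n))
    (f := fun z : ℝ × (Fin n → ℝ) => F (a + z.1 + ∑ i, z.2 i)) (by fun_prop)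
  rw [← hpre] at hcomp
  rw [Measure.volume_eq_prod, ← Measure.prod_restrict, lintegral_prod _ (by fun_prop)] at hcomp
  rw [← hcomp]
  refine lintegral_congr fun x => ?_
  simp [MeasurableEquiv.piFinSuccAbove, Fin.sum_univ_succ, Fin.tail, add_assoc]

lemma sum_one_div_sub_nonneg {n : ℕ} {β : ℝ} (hβ : (n : ℝ) < β) :
    0 ≤ ∑ i ∈ Finset.Icc 1 n, 1 / (β - (i : ℝ)) := by
  refine Finset.sum_nonneg fun i hi => ?_
  have : (i : ℝ) ≤ n := by exact_mod_cast (Finset.mem_Icc.1 hi).2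
  exact one_div_nonneg.2 (by linarith)

lemma prod_sub_pos {n : ℕ} {β : ℝ} (hβ : (n : ℝ) < β) :
    0 < ∏ i ∈ Finset.Icc 1 n, (β - (i : ℝ)) := by
  refine Finset.prod_pos fun i hi => ?_
  have : (i : ℝ) ≤ n := by exact_mod_cast (Finset.mem_Icc.1 hi).2
  linarith

lemma lintegral_pi_pos_rpow_mul_log {a₀ : ℝ} (ha₀ : 0 < a₀) (n : ℕ) :
    ∀ {a p e d : ℝ}, a₀ ≤ a → (n : ℝ) < p → 0 ≤ e → 0 ≤ d →
    ∫⁻ x in {x : Fin n → ℝ | ∀ i, 0 < x i}, ENNReal.ofReal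
        ((a + ∑ i, x i) ^ (-p) * (e * Real.log ((a + ∑ i, x i) / a₀) + d))
      = ENNReal.ofReal (a ^ (n - p) / (∏ i ∈ Finset.Icc 1 n, (p - (i : ℝ))) *
          (e * Real.log (a / a₀) + (d + e * ∑ i ∈ Finset.Icc 1 n, 1 / (p - (i : ℝ))))) := by
  induction n with
  | zero =>
    intro a p e d ha hp he hd
    have : {x : Fin 0 → ℝ | ∀ i, 0 < x i} = Set.univ := by ext; simp
    rw [this, Measure.restrict_univ, lintegral_unique]
    simp [volume_pi]
  | succ n ih =>
    intro a p e d ha hp he hd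
    push_cast at hp
    have hnp : (n : ℝ) < p := by linarith
    rw [lintegral_pi_pos_succ n
      (F := fun t => ENNReal.ofReal (t ^ (-p) * (e * Real.log (t / a₀) + d))) (by fun_prop)]
    have hP := prod_sub_pos hnp
    have hS := sum_one_div_sub_nonneg hnp
    have h1 : ∀ y ∈ Set.Ioi (0 : ℝ),
        ∫⁻ x in {x : Fin n → ℝ | ∀ i, 0 < x i}, ENNReal.ofReal
          ((a + y + ∑ i, x i) ^ (-p) * (e * Real.log ((a + y + ∑ i, x i) / a₀) + d))
        = ENNReal.ofReal (1 / (∏ i ∈ Finset.Icc 1 n, (p - (i : ℝ)))) *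
          ENNReal.ofReal ((a + y) ^ (-(p - n)) * (e * Real.log ((a + y) / a₀) +
            (d + e * ∑ i ∈ Finset.Icc 1 n, 1 / (p - (i : ℝ))))) := by
      intro y hy
      rw [ih (by linarith [show (0 : ℝ) < y from hy]) hnp he hd, ← ENNReal.ofReal_mul (by positivity)]
      congr 1
      rw [neg_sub]
      ring
    rw [setLIntegral_congr_fun measurableSet_Ioi h1, lintegral_const_mul _ (by fun_prop),
      lintegral_Ioi_rpow_mul_log ha₀ ha (by linarith) he (by positivity),
      ← ENNReal.ofReal_mul (by positivity)]
    congr 1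
    rw [Finset.prod_Icc_succ_top (by omega), Finset.sum_Icc_succ_top (by omega)]
    push_cast
    have : p - n - 1 ≠ 0 := by linarith
    have : p - (n + 1) ≠ 0 := by linarith
    rw [show 1 - (p - n) = (n : ℝ) + 1 - p by ring, show p - n - 1 = p - ((n : ℝ) + 1) by ring]
    field_simp
    ring

lemma measurableSet_posOrthant (n : ℕ) : MeasurableSet (posOrthant n) := by
  rw [posOrthant, Set.ofPred_forall]
  exact MeasurableSet.iInter fun i => measurableSet_lt measurable_const (by fun_prop)

/-- The integrals behind the normalization (`e = 0`) and the entropy (`e = 1`) of the Pareto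
density. -/
lemma lintegral_posOrthant_rpow_mul_log {n : ℕ} {a₀ a p e d : ℝ} (ha₀ : 0 < a₀) (ha : a₀ ≤ a)
    (hp : (n : ℝ) < p) (he : 0 ≤ e) (hd : 0 ≤ d) :
    ∫⁻ x in posOrthant n, ENNReal.ofReal
        ((a + ∑ i, x i) ^ (-p) * (e * Real.log ((a + ∑ i, x i) / a₀) + d))
      = ENNReal.ofReal (a ^ (n - p) / (∏ i ∈ Finset.Icc 1 n, (p - (i : ℝ))) *
          (e * Real.log (a / a₀) + (d + e * ∑ i ∈ Finset.Icc 1 n, 1 / (p - (i : ℝ))))) := by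
  rw [← lintegral_pi_pos_rpow_mul_log ha₀ n ha hp he hd]
  have hmp := (EuclideanSpace.volume_preserving_symm_measurableEquiv_toLp (Fin n))
  have hmeas : MeasurableSet {x : Fin n → ℝ | ∀ i, 0 < x i} := by
    rw [Set.ofPred_forall]
    exact MeasurableSet.iInter fun i => measurableSet_lt measurable_const (measurable_pi_apply i)
  exact hmp.setLIntegral_comp_preimage (s := {x : Fin n → ℝ | ∀ i, 0 < x i}) hmeas
    (f := fun x : Fin n → ℝ => ENNReal.ofReal
        ((a + ∑ i, x i) ^ (-p) * (e * Real.log ((a + ∑ i, x i) / a₀) + d))) (by fun_prop)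

/-! ### The test function -/

/-- The function `t ↦ (c - log t) t ^ (-β)`, whose integral against the level distribution of `φ`
has to be shown nonnegative. -/
def logWeight (β c t : ℝ) : ℝ := (c - Real.log t) * t ^ (-β)

lemma hasDerivAt_logWeight {β : ℝ} (c : ℝ) {t : ℝ} (hβ : β ≠ 0) (ht : 0 < t) :
    HasDerivAt (logWeight β c) (β * (Real.log t - (c + 1 / β)) * t ^ (-β - 1)) t := by
  have h := ((Real.hasDerivAt_log ht.ne').const_sub c).mul
    (Real.hasDerivAt_rpow_const (p := -β) (Or.inl ht.ne'))
  refine h.congr_deriv ?_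
  have : t ^ (-β) = t ^ (-β - 1) * t := by
    rw [← Real.rpow_add_one ht.ne']; ring_nf
  rw [this]
  field_simp
  ring

lemma antitoneOn_logWeight {β c t₀ : ℝ} (hβ : 0 < β) (ht₀ : Real.log t₀ = c + 1 / β) :
    AntitoneOn (logWeight β c) (Set.Ioc 0 t₀) := by
  refine antitoneOn_of_deriv_nonpos (convex_Ioc 0 t₀)
    (fun t ht => (hasDerivAt_logWeight c hβ.ne' ht.1).continuousAt.continuousWithinAt) ?_ ?_
  · rw [interior_Ioc]
    exact fun t ht =>
      (hasDerivAt_logWeight c hβ.ne' ht.1).differentiableAt.differentiableWithinAt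
  · rw [interior_Ioc]
    intro t ht
    rw [(hasDerivAt_logWeight c hβ.ne' ht.1).deriv, ← ht₀]
    have := Real.log_le_log ht.1 ht.2.le
    exact mul_nonpos_of_nonpos_of_nonneg
      (mul_nonpos_of_nonneg_of_nonpos hβ.le (by linarith)) (Real.rpow_nonneg ht.1.le _)

lemma monotoneOn_logWeight {β c t₀ : ℝ} (hβ : 0 < β) (h0 : 0 < t₀)
    (ht₀ : Real.log t₀ = c + 1 / β) : MonotoneOn (logWeight β c) (Set.Ici t₀) := by
  have hpos : ∀ t ∈ Set.Ici t₀, 0 < t := fun t ht => h0.trans_le ht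
  refine monotoneOn_of_deriv_nonneg (convex_Ici t₀)
    (fun t ht => (hasDerivAt_logWeight c hβ.ne' (hpos t ht)).continuousAt.continuousWithinAt) ?_ ?_
  · rw [interior_Ici]
    exact fun t ht => (hasDerivAt_logWeight c hβ.ne'
      (hpos t (Set.Ioi_subset_Ici_self ht))).differentiableAt.differentiableWithinAt
  · rw [interior_Ici]
    intro t ht
    have htp := hpos t (Set.Ioi_subset_Ici_self ht)
    rw [(hasDerivAt_logWeight c hβ.ne' htp).deriv, ← ht₀]
    have := Real.log_le_log h0 (le_of_lt ht)
    exact mul_nonneg (mul_nonneg hβ.le (by linarith)) (Real.rpow_nonneg htp.le _)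

/-- On `[1, ∞)`, the part of `logWeight` that decreases on `[1, t₀]` and vanishes beyond `t₀`. The
truncation at `1` makes it nonincreasing and continuous on the whole line. -/
def lowPart (β c t₀ t : ℝ) : ℝ := logWeight β c (min (max t 1) t₀) - logWeight β c t₀

/-- The nonnegative function that is subtracted from `lowPart` to give `logWeight`; it is constant
up to `t₀` and decreases to `0` beyond `t₀`. -/
def highPart (β c t₀ t : ℝ) : ℝ := -logWeight β c (max t t₀)

section Parts

variable {β c t₀ : ℝ}

lemma continuous_logWeight_comp (hβ : 0 < β) {g : ℝ → ℝ} (hg : Continuous g)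
    (hg0 : ∀ t, 0 < g t) : Continuous fun t => logWeight β c (g t) :=
  continuous_iff_continuousAt.2 fun t =>
    ContinuousAt.comp (f := g) (hasDerivAt_logWeight c hβ.ne' (hg0 t)).continuousAt hg.continuousAt

lemma continuous_lowPart (hβ : 0 < β) (h1 : 1 ≤ t₀) : Continuous (lowPart β c t₀) :=
  (continuous_logWeight_comp hβ (by fun_prop)
    fun t => lt_min (by positivity) (by linarith)).sub continuous_const

lemma continuous_highPart (hβ : 0 < β) (h1 : 1 ≤ t₀) : Continuous (highPart β c t₀) :=
  (continuous_logWeight_comp hβ (by fun_prop) fun t => lt_max_of_lt_right (by linarith)).neg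

lemma antitone_lowPart (hβ : 0 < β) (h1 : 1 ≤ t₀) (ht₀ : Real.log t₀ = c + 1 / β) :
    Antitone (lowPart β c t₀) := by
  intro s t hst
  refine sub_le_sub_right (antitoneOn_logWeight hβ ht₀ ⟨?_, min_le_right _ _⟩
    ⟨?_, min_le_right _ _⟩ (min_le_min_right _ (max_le_max_right _ hst))) _ <;>
  exact lt_min (by positivity) (by linarith)

lemma antitone_highPart (hβ : 0 < β) (h1 : 1 ≤ t₀) (ht₀ : Real.log t₀ = c + 1 / β) :
    Antitone (highPart β c t₀) := fun s t hst =>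
  neg_le_neg (monotoneOn_logWeight hβ (by linarith) ht₀ (le_max_right s t₀) (le_max_right t t₀)
    (max_le_max_right _ hst))

lemma lowPart_of_le (h1 : 1 ≤ t₀) {t : ℝ} (ht : t₀ ≤ t) : lowPart β c t₀ t = 0 := by
  rw [lowPart, max_eq_left (h1.trans ht), min_eq_right ht, sub_self]

lemma lowPart_nonneg (hβ : 0 < β) (h1 : 1 ≤ t₀) (ht₀ : Real.log t₀ = c + 1 / β) (t : ℝ) :
    0 ≤ lowPart β c t₀ t := by
  rw [← lowPart_of_le (β := β) (c := c) h1 (le_max_right t t₀)]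
  exact antitone_lowPart hβ h1 ht₀ (le_max_left t t₀)

lemma highPart_nonneg (hβ : 0 < β) (h1 : 1 ≤ t₀) (ht₀ : Real.log t₀ = c + 1 / β) (t : ℝ) :
    0 ≤ highPart β c t₀ t := by
  have h : Real.log t₀ ≤ Real.log (max t t₀) := Real.log_le_log (by linarith) (le_max_right _ _)
  have h2 : 0 < 1 / β := by positivity
  rw [highPart, logWeight, ← neg_mul]
  exact mul_nonneg (by linarith) (Real.rpow_nonneg ((by linarith : 0 ≤ t₀).trans (le_max_right _ _)) _)

lemma rpow_mul_log_add_lowPart {t : ℝ} (ht : 1 ≤ t) :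
    t ^ (-β) * Real.log t + lowPart β c t₀ t = c * t ^ (-β) + highPart β c t₀ t := by
  rw [lowPart, highPart, max_eq_left ht]
  rcases le_total t t₀ with h | h
  · rw [min_eq_left h, max_eq_right h]; simp only [logWeight]; ring
  · rw [min_eq_right h, max_eq_left h]; simp only [logWeight]; ring

lemma lowPart_le (hβ : 0 < β) (h1 : 1 ≤ t₀) (ht₀ : Real.log t₀ = c + 1 / β) {t : ℝ} (ht : 1 ≤ t) :
    lowPart β c t₀ t ≤ Real.log t₀ * t ^ (-β) := by
  have hl := Real.log_nonneg h1
  rcases le_total t₀ t with h | h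
  · rw [lowPart_of_le h1 h]; positivity
  · have e := rpow_mul_log_add_lowPart (β := β) (c := c) (t₀ := t₀) ht
    have h3 : t₀ ^ (-β) ≤ t ^ (-β) :=
      Real.rpow_le_rpow_of_nonpos (by linarith) h (by linarith)
    have h4 : highPart β c t₀ t = 1 / β * t₀ ^ (-β) := by
      rw [highPart, max_eq_right h, logWeight, ht₀]; ring
    have h5 : 1 / β * t₀ ^ (-β) ≤ 1 / β * t ^ (-β) := by gcongr
    have h6 : 0 ≤ t ^ (-β) * Real.log t :=
      mul_nonneg (by positivity) (Real.log_nonneg ht)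
    rw [ht₀]
    linarith

/-- Integrated form of the decomposition of `logWeight`. -/
lemma lintegral_rpow_mul_log_add_lowPart {α : Type*} [MeasurableSpace α] {μ : Measure α}
    {u : α → ℝ} (hu : Measurable u) (hu1 : ∀ᵐ x ∂μ, 1 ≤ u x) (hβ : 0 < β) (hc : 0 ≤ c)
    (h1 : 1 ≤ t₀) (ht₀ : Real.log t₀ = c + 1 / β) :
    ∫⁻ x, ENNReal.ofReal (u x ^ (-β) * Real.log (u x)) ∂μ
        + ∫⁻ x, ENNReal.ofReal (lowPart β c t₀ (u x)) ∂μ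
      = ENNReal.ofReal c * ∫⁻ x, ENNReal.ofReal (u x ^ (-β)) ∂μ
        + ∫⁻ x, ENNReal.ofReal (highPart β c t₀ (u x)) ∂μ := by
  have hm1 : Measurable fun x => lowPart β c t₀ (u x) :=
    (continuous_lowPart hβ h1).measurable.comp hu
  have hm2 : Measurable fun x => highPart β c t₀ (u x) :=
    (continuous_highPart hβ h1).measurable.comp hu
  rw [← lintegral_const_mul _ (by fun_prop), ← lintegral_add_right _ (by fun_prop),
    ← lintegral_add_right _ (by fun_prop)]
  refine lintegral_congr_ae ?_
  filter_upwards [hu1] with x hx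
  have := rpow_mul_log_add_lowPart (β := β) (c := c) (t₀ := t₀) hx
  have hp : 0 ≤ u x ^ (-β) := Real.rpow_nonneg (by linarith) _
  rw [← ENNReal.ofReal_mul hc, ← ENNReal.ofReal_add (mul_nonneg hp (Real.log_nonneg hx))
    (lowPart_nonneg hβ h1 ht₀ _), this,
    ENNReal.ofReal_add (mul_nonneg hc hp) (highPart_nonneg hβ h1 ht₀ _)]

lemma lintegral_lowPart_ne_top {α : Type*} [MeasurableSpace α] {μ : Measure α}
    {u : α → ℝ} (hu1 : ∀ᵐ x ∂μ, 1 ≤ u x) (hβ : 0 < β)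
    (h1 : 1 ≤ t₀) (ht₀ : Real.log t₀ = c + 1 / β)
    (hint : ∫⁻ x, ENNReal.ofReal (u x ^ (-β)) ∂μ ≠ ∞) :
    ∫⁻ x, ENNReal.ofReal (lowPart β c t₀ (u x)) ∂μ ≠ ∞ := by
  refine ne_top_of_le_ne_top (ENNReal.mul_ne_top (ENNReal.ofReal_ne_top (r := Real.log t₀)) hint) ?_
  rw [← lintegral_const_mul' _ _ ENNReal.ofReal_ne_top]
  refine lintegral_mono_ae ?_
  filter_upwards [hu1] with x hx
  rw [← ENNReal.ofReal_mul (Real.log_nonneg h1)]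
  exact ENNReal.ofReal_le_ofReal (lowPart_le hβ h1 ht₀ hx)

end Parts

/-! ### Measures of sublevel sets -/

lemma isOpen_posOrthant (n : ℕ) : IsOpen (posOrthant n) := by
  rw [posOrthant, Set.ofPred_forall]
  exact isOpen_iInter_of_finite fun i => isOpen_lt continuous_const (by fun_prop)

/-- Markov's inequality for `φ ^ (-β)`, on a sublevel set of `φ`. -/
lemma rpow_mul_measure_sublevel_le {α : Type*} [MeasurableSpace α] {μ : Measure α} {Ω : Set α}
    {φ : α → ℝ} (hΩ : MeasurableSet Ω) (hφ : Measurable φ) (hpos : ∀ x ∈ Ω, 0 < φ x) {β t : ℝ}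
    (hβ : 0 ≤ β) :
    ENNReal.ofReal (t ^ (-β)) * μ {x | x ∈ Ω ∧ φ x < t}
      ≤ ∫⁻ x in Ω, ENNReal.ofReal (φ x ^ (-β)) ∂μ := by
  have hmeas : MeasurableSet {x | x ∈ Ω ∧ φ x < t} := hΩ.inter (measurableSet_lt hφ measurable_const)
  rw [← setLIntegral_const]
  refine (setLIntegral_mono' hmeas fun x hx => ?_).trans
    (lintegral_mono_set (s := {x | x ∈ Ω ∧ φ x < t}) fun x hx => hx.1)
  exact ENNReal.ofReal_le_ofReal
    (Real.rpow_le_rpow_of_nonpos (hpos x hx.1) hx.2.le (by linarith))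

lemma measure_sublevel_ne_top {α : Type*} [MeasurableSpace α] {μ : Measure α} {Ω : Set α}
    {φ : α → ℝ} (hΩ : MeasurableSet Ω) (hφ : Measurable φ) (hpos : ∀ x ∈ Ω, 0 < φ x) {β t : ℝ}
    (hβ : 0 ≤ β) (ht : 0 < t) (hint : ∫⁻ x in Ω, ENNReal.ofReal (φ x ^ (-β)) ∂μ ≠ ∞) :
    μ {x | x ∈ Ω ∧ φ x < t} ≠ ∞ := by
  intro h
  have := rpow_mul_measure_sublevel_le (μ := μ) (t := t) hΩ hφ hpos hβ
  rw [h, ENNReal.mul_top (by simpa using Real.rpow_pos_of_pos ht _)] at this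
  exact hint (top_le_iff.1 this)

lemma volume_posOrthant_sublevel {n : ℕ} {s t : ℝ} (hs : 1 < s) (ht : 1 < t) :
    volume {x : Vec n | x ∈ posOrthant n ∧ 1 + ∑ i, x i < t}
      = ENNReal.ofReal (((t - 1) / (s - 1)) ^ n) *
        volume {x : Vec n | x ∈ posOrthant n ∧ 1 + ∑ i, x i < s} := by
  have hr : 0 < (t - 1) / (s - 1) := div_pos (by linarith) (by linarith)
  have h := Measure.addHaar_smul (volume : Measure (Vec n)) ((t - 1) / (s - 1))
    {x : Vec n | x ∈ posOrthant n ∧ 1 + ∑ i, x i < s}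
  rw [finrank_euclideanSpace_fin, abs_of_pos (pow_pos hr _)] at h
  rw [← h]
  congr 1
  ext x
  rw [Set.mem_smul_set_iff_inv_smul_mem₀ hr.ne']
  simp only [posOrthant, Set.mem_ofPred_eq, PiLp.smul_apply, smul_eq_mul, ← Finset.mul_sum]
  refine and_congr (forall_congr' fun i => ?_) ?_
  · exact (mul_pos_iff_of_pos_left (inv_pos.2 hr)).symm
  · rw [inv_div, ← lt_sub_iff_add_lt', ← lt_sub_iff_add_lt', div_mul_eq_mul_div,
      div_lt_iff₀ (by linarith), mul_lt_mul_iff_right₀ (by linarith)]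

lemma volume_posOrthant_sublevel_pos {n : ℕ} {t : ℝ} (ht : 1 < t) :
    volume {x : Vec n | x ∈ posOrthant n ∧ 1 + ∑ i, x i < t} ≠ 0 := by
  have ho : IsOpen {x : Vec n | x ∈ posOrthant n ∧ 1 + ∑ i, x i < t} :=
    (isOpen_posOrthant n).inter (isOpen_lt (f := fun x : Vec n => 1 + ∑ i, x i) (by fun_prop)
      continuous_const)
  refine (ho.measure_pos volume ⟨WithLp.toLp 2 fun _ => (t - 1) / (n + 1), ?_, ?_⟩).ne'
  · intro i
    exact div_pos (by linarith) (by positivity)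
  · have : (n : ℝ) * ((t - 1) / (n + 1)) < t - 1 := by
      rw [mul_div_assoc', div_lt_iff₀ (by positivity)]
      nlinarith
    simp
    linarith

/-! ### The entropy inequality -/

/-- For the Pareto function the two parts of `logWeight` have the same integral. -/
lemma lintegral_posOrthant_lowPart_eq {n : ℕ} {β t₀ : ℝ} (hβ : (n : ℝ) < β) (h1 : 1 ≤ t₀)
    (ht₀ : Real.log t₀ = ∑ i ∈ Finset.Icc 1 n, 1 / (β - (i : ℝ)) + 1 / β) :
    ∫⁻ x in posOrthant n, ENNReal.ofReal
        (lowPart β (∑ i ∈ Finset.Icc 1 n, 1 / (β - (i : ℝ))) t₀ (1 + ∑ i, x i))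
      = ∫⁻ x in posOrthant n, ENNReal.ofReal
        (highPart β (∑ i ∈ Finset.Icc 1 n, 1 / (β - (i : ℝ))) t₀ (1 + ∑ i, x i)) := by
  have hβ0 : 0 < β := lt_of_le_of_lt (Nat.cast_nonneg n) hβ
  have hc := sum_one_div_sub_nonneg hβ
  have hu1 : ∀ᵐ x ∂(volume.restrict (posOrthant n)), 1 ≤ 1 + ∑ i, x i :=
    (ae_restrict_iff' (measurableSet_posOrthant n)).2 <| Eventually.of_forall fun x hx => by
      have : 0 ≤ ∑ i, x i := Finset.sum_nonneg fun i _ => (hx i).le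
      linarith
  have h := lintegral_rpow_mul_log_add_lowPart (μ := volume.restrict (posOrthant n))
    (u := fun x => 1 + ∑ i, x i) (by fun_prop) hu1 hβ0 hc h1 ht₀
  have e0 := lintegral_posOrthant_rpow_mul_log (n := n) (e := 0) (d := 1) one_pos (le_refl 1) hβ
    le_rfl zero_le_one
  have e1 := lintegral_posOrthant_rpow_mul_log (n := n) (e := 1) (d := 0) one_pos (le_refl 1) hβ
    zero_le_one le_rfl
  simp only [zero_mul, zero_add, mul_one, Real.one_rpow, add_zero, div_one, one_mul,
    Real.log_one] at e0 e1
  rw [e0, e1, ← ENNReal.ofReal_mul hc, mul_comm (∑ i ∈ Finset.Icc 1 n, 1 / (β - (i : ℝ)))] at h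
  exact (ENNReal.add_right_inj ENNReal.ofReal_ne_top).1 h

/-- The sharp bound on the mean of `log φ` under the density proportional to `φ ^ (-β)`, for a
convex function with infimum `1`. -/
lemma lintegral_rpow_neg_mul_log_le {n : ℕ} {β : ℝ} (hβ : (n : ℝ) < β) {Ω : Set (Vec n)}
    (hΩ : MeasurableSet Ω) {φ : Vec n → ℝ} (hφ : ConvexOn ℝ Ω φ) (hφm : Measurable φ)
    (hm : IsGLB (φ '' Ω) 1) (hint : ∫⁻ x in Ω, ENNReal.ofReal (φ x ^ (-β)) ≠ ∞) :
    ∫⁻ x in Ω, ENNReal.ofReal (φ x ^ (-β) * Real.log (φ x))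
      ≤ ENNReal.ofReal (∑ i ∈ Finset.Icc 1 n, 1 / (β - (i : ℝ))) *
        ∫⁻ x in Ω, ENNReal.ofReal (φ x ^ (-β)) := by
  have hβ0 : 0 < β := lt_of_le_of_lt (Nat.cast_nonneg n) hβ
  have hc := sum_one_div_sub_nonneg hβ
  set c := ∑ i ∈ Finset.Icc 1 n, 1 / (β - (i : ℝ)) with hcdef
  -- the crossing level `t₀` is where `logWeight` is minimal
  set t₀ := Real.exp (c + 1 / β) with ht₀def
  have ht₀ : Real.log t₀ = c + 1 / β := Real.log_exp _
  have h1' : 1 < t₀ := Real.one_lt_exp_iff.2 (by positivity)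
  have h1 := h1'.le
  have hu1 : ∀ x ∈ Ω, 1 ≤ φ x := fun x hx => hm.1 ⟨x, hx, rfl⟩
  have hu1' : ∀ᵐ x ∂(volume.restrict Ω), 1 ≤ φ x :=
    (ae_restrict_iff' hΩ).2 (Eventually.of_forall hu1)
  set v : Vec n → ℝ := fun x => 1 + ∑ i, x i with hv
  have hvm : Measurable v := by fun_prop
  set V : ℝ → ℝ≥0∞ := fun t => volume {x | x ∈ Ω ∧ φ x < t} with hV
  set W : ℝ → ℝ≥0∞ := fun t => volume {x : Vec n | x ∈ posOrthant n ∧ v x < t} with hW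
  have hW0 : W t₀ ≠ 0 := volume_posOrthant_sublevel_pos h1'
  have hvpos : ∀ x ∈ posOrthant n, 1 ≤ v x := fun x hx => by
    have : 0 ≤ ∑ i, x i := Finset.sum_nonneg fun i _ => (hx i).le
    simp only [hv]; linarith
  have hWtop : W t₀ ≠ ∞ := by
    refine measure_sublevel_ne_top (β := β) (measurableSet_posOrthant n) hvm
      (fun x hx => by linarith [hvpos x hx]) hβ0.le (by linarith) ?_
    have e0 := lintegral_posOrthant_rpow_mul_log (n := n) (e := 0) (d := 1) one_pos (le_refl 1) hβ
      le_rfl zero_le_one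
    simp only [zero_mul, zero_add, mul_one] at e0
    rw [e0]
    exact ENNReal.ofReal_ne_top
  -- the multiple of Lebesgue measure on the orthant for which the level distributions cross at `t₀`
  set κ := V t₀ / W t₀ with hκ
  have hκW : ∀ t, 1 < t → κ * W t = ENNReal.ofReal (((t - 1) / (t₀ - 1)) ^ n) * V t₀ := by
    intro t ht
    simp only [hW]
    rw [volume_posOrthant_sublevel h1' ht, mul_left_comm]
    congr 1
    exact ENNReal.div_mul_cancel hW0 hWtop
  have hrestr : ∀ (t : ℝ), (volume.restrict Ω) {x | φ x < t} = V t := fun t => by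
    rw [Measure.restrict_apply (measurableSet_lt hφm measurable_const), Set.inter_comm]
    rfl
  have hrestr' : ∀ (t : ℝ), (κ • volume.restrict (posOrthant n)) {x | v x < t} = κ * W t :=
    fun t => by
      rw [Measure.smul_apply, Measure.restrict_apply (measurableSet_lt hvm measurable_const),
        Set.inter_comm]
      rfl
  have hlow : ∫⁻ x, ENNReal.ofReal (lowPart β c t₀ (v x)) ∂(κ • volume.restrict (posOrthant n))
      ≤ ∫⁻ x in Ω, ENNReal.ofReal (lowPart β c t₀ (φ x)) := by
    refine lintegral_comp_antitone_le hvm.aemeasurable hφm.aemeasurable (antitone_lowPart hβ0 h1 ht₀)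
      (continuous_lowPart hβ0 h1) (lowPart_nonneg hβ0 h1 ht₀) fun q hq => ?_
    have hq0 : q < t₀ := by
      by_contra h
      rw [lowPart_of_le h1 (not_lt.1 h)] at hq
      exact lt_irrefl _ hq
    rw [hrestr, hrestr']
    rcases lt_or_ge 1 q with hq1 | hq1
    · rw [hκW q hq1]
      simpa only [finrank_euclideanSpace_fin] using measure_sublevel_ratio volume hφ hm hq1 hq0.le
    · have : W q = 0 := by
        have : {x : Vec n | x ∈ posOrthant n ∧ v x < q} = ∅ :=
          Set.eq_empty_of_forall_notMem fun x hx => by linarith [hvpos x hx.1, hx.2]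
        simp only [hW, this, measure_empty]
      rw [this, mul_zero]
      exact zero_le
  have hhigh : ∫⁻ x in Ω, ENNReal.ofReal (highPart β c t₀ (φ x))
      ≤ ∫⁻ x, ENNReal.ofReal (highPart β c t₀ (v x)) ∂(κ • volume.restrict (posOrthant n)) := by
    -- `highPart` only sees the values above `t₀`
    have hmax : ∀ t, highPart β c t₀ (max t t₀) = highPart β c t₀ t := fun t => by
      simp only [highPart, max_assoc, max_self]
    have := lintegral_comp_antitone_le (μ := volume.restrict Ω)
      (ν := κ • volume.restrict (posOrthant n)) (u := fun x => max (φ x) t₀)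
      (v := fun x => max (v x) t₀) (hφm.max measurable_const).aemeasurable
      (hvm.max measurable_const).aemeasurable (antitone_highPart hβ0 h1 ht₀)
      (continuous_highPart hβ0 h1) (highPart_nonneg hβ0 h1 ht₀) fun q _ => ?_
    · simpa only [hmax] using this
    · rcases le_or_gt q t₀ with hq | hq
      · have : {x | max (φ x) t₀ < q} = ∅ :=
          Set.eq_empty_of_forall_notMem fun x hx => by
            have hx' : max (φ x) t₀ < q := hx
            linarith [le_max_right (φ x) t₀]
        rw [this, measure_empty]
        exact zero_le
      · simp only [max_lt_iff, hq, and_true]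
        rw [hrestr, hrestr', hκW q (h1'.trans hq)]
        have hr := measure_sublevel_ratio volume hφ hm h1' hq.le
        rw [finrank_euclideanSpace_fin] at hr
        have hr0 : 0 < (q - 1) / (t₀ - 1) := div_pos (by linarith) (by linarith)
        calc V q = ENNReal.ofReal (((q - 1) / (t₀ - 1)) ^ n) *
              (ENNReal.ofReal (((t₀ - 1) / (q - 1)) ^ n) * V q) := by
              rw [← mul_assoc, ← ENNReal.ofReal_mul (by positivity), ← mul_pow, ← inv_div (q - 1),
                mul_inv_cancel₀ hr0.ne', one_pow, ENNReal.ofReal_one, one_mul]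
          _ ≤ _ := by gcongr
  have heq : ∫⁻ x, ENNReal.ofReal (lowPart β c t₀ (v x)) ∂(κ • volume.restrict (posOrthant n))
      = ∫⁻ x, ENNReal.ofReal (highPart β c t₀ (v x)) ∂(κ • volume.restrict (posOrthant n)) := by
    rw [lintegral_smul_measure, lintegral_smul_measure]
    exact congrArg _ (lintegral_posOrthant_lowPart_eq hβ h1 ht₀)
  have hfin := lintegral_lowPart_ne_top hu1' hβ0 h1 ht₀ hint
  have hid := lintegral_rpow_mul_log_add_lowPart hφm hu1' hβ0 hc h1 ht₀
  refine (ENNReal.add_le_add_iff_right hfin).1 ?_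
  rw [hid]
  exact add_le_add le_rfl (hhigh.trans (heq.ge.trans hlow))

/-! ### Densities of the form `φ ^ (-β)` -/

/-- A probability density `f` with a fixed representation `f = φ ^ (-β)` on the open convex set
`Ω`, `f = 0` elsewhere, in which `φ` is measurable on the whole space. -/
structure ConvexRep {n : ℕ} (β : ℝ) (f : Vec n → ℝ) (Ω : Set (Vec n)) (φ : Vec n → ℝ) : Prop where
  isProbDensity : IsProbDensity f
  isOpen : IsOpen Ω
  convexOn : ConvexOn ℝ Ω φ
  measurable : Measurable φ
  pos : ∀ x ∈ Ω, 0 < φ x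
  eq_rpow : ∀ x ∈ Ω, f x = φ x ^ (-β)
  eq_zero : ∀ x ∉ Ω, f x = 0

/-- The function `φ` can be recovered on `Ω` as `f ^ (-1 / β)`, which is measurable. -/
lemma IsConvexForm.exists_convexRep {n : ℕ} {β : ℝ} {f : Vec n → ℝ} (hβ : 0 < β)
    (hf : IsProbDensity f) (h : IsConvexForm β f) : ∃ Ω φ, ConvexRep β f Ω φ := by
  obtain ⟨Ω, φ, hΩ, -, hφ, hpos, h1, h0⟩ := h
  have e : Set.EqOn φ (fun x => f x ^ (-β⁻¹)) Ω := fun x hx => by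
    simp only [h1 x hx]
    rw [← Real.rpow_mul (hpos x hx).le, neg_mul_neg, mul_inv_cancel₀ hβ.ne', Real.rpow_one]
  refine ⟨Ω, fun x => f x ^ (-β⁻¹), hf, hΩ, hφ.congr e, hf.measurable.pow_const _, ?_, ?_, h0⟩
  · intro x hx; exact (hpos x hx).trans_eq (e hx)
  · intro x hx; exact (h1 x hx).trans (congrArg (· ^ (-β)) (e hx))

namespace ConvexRep

variable {n : ℕ} {β : ℝ} {f : Vec n → ℝ} {Ω : Set (Vec n)} {φ : Vec n → ℝ} {m : ℝ}

lemma lintegral_mul (h : ConvexRep β f Ω φ) (k : Vec n → ℝ) :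
    ∫⁻ x, ENNReal.ofReal (f x * k x) = ∫⁻ x in Ω, ENNReal.ofReal (φ x ^ (-β) * k x) := by
  rw [← lintegral_indicator h.isOpen.measurableSet]
  refine lintegral_congr fun x => ?_
  by_cases hx : x ∈ Ω
  · rw [Set.indicator_of_mem hx, h.eq_rpow x hx]
  · rw [Set.indicator_of_notMem hx, h.eq_zero x hx, zero_mul, ENNReal.ofReal_zero]

lemma lintegral_rpow (h : ConvexRep β f Ω φ) : ∫⁻ x in Ω, ENNReal.ofReal (φ x ^ (-β)) = 1 := by
  have := h.lintegral_mul (fun _ => 1)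
  simp only [mul_one] at this
  rw [← this, h.isProbDensity.lintegral_eq_one]

lemma measure_ne_zero (h : ConvexRep β f Ω φ) : volume Ω ≠ 0 := by
  intro h0
  have := h.lintegral_rpow
  rw [Measure.restrict_eq_zero.2 h0, lintegral_zero_measure] at this
  exact zero_ne_one this

lemma nonempty (h : ConvexRep β f Ω φ) : Ω.Nonempty := by
  by_contra h0
  rw [Set.not_nonempty_iff_eq_empty] at h0
  exact h.measure_ne_zero (by rw [h0, measure_empty])

lemma exists_sublevel_ne_zero (h : ConvexRep β f Ω φ) (b : ℝ) :
    ∃ t, b < t ∧ volume {x | x ∈ Ω ∧ φ x < t} ≠ 0 := by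
  by_contra! hcon
  refine h.measure_ne_zero (measure_mono_null (t := ⋃ k : ℕ, {x | x ∈ Ω ∧ φ x < b + 1 + k}) ?_
    (measure_iUnion_null fun k => hcon _ ?_))
  · intro x hx
    obtain ⟨k, hk⟩ := exists_nat_gt (φ x - (b + 1))
    exact Set.mem_iUnion.2 ⟨k, hx, by linarith⟩
  · have : (0 : ℝ) ≤ k := Nat.cast_nonneg k
    linarith

/-- The infimum of `φ` is positive: near a point where `φ` is at most `ε`, the density is at least
`(2 ε) ^ (-β)` on a set of measure of order `ε ^ n`, and `β > n`. -/
lemma exists_isGLB (h : ConvexRep β f Ω φ) (hβ : (n : ℝ) < β) :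
    ∃ m, 0 < m ∧ IsGLB (φ '' Ω) m := by
  have hβ0 : 0 < β := lt_of_le_of_lt (Nat.cast_nonneg n) hβ
  obtain ⟨t, ht, hV⟩ := h.exists_sublevel_ne_zero 0
  have hVtop : volume {x | x ∈ Ω ∧ φ x < t} ≠ ∞ :=
    measure_sublevel_ne_top h.isOpen.measurableSet h.measurable h.pos hβ0.le ht
      (by rw [h.lintegral_rpow]; exact ENNReal.one_ne_top)
  set K := (volume {x | x ∈ Ω ∧ φ x < t}).toReal with hK
  have hK0 : 0 < K := ENNReal.toReal_pos hV hVtop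
  set δ := (K / (t ^ n * 2 ^ β)) ^ (β - n)⁻¹ with hδ
  have hδ0 : 0 < δ := by positivity
  have hbd : ∀ x ∈ Ω, min δ t ≤ φ x := by
    intro x₀ hx₀
    rcases le_or_gt t (φ x₀) with hle | hlt
    · exact (min_le_right _ _).trans hle
    refine (min_le_left _ _).trans ?_
    have hε := h.pos x₀ hx₀
    set ε := φ x₀
    have h1 := measure_sublevel_homothety volume h.convexOn hx₀ (div_pos hε ht)
      ((div_le_one ht).2 hlt.le) t
    have h2 := rpow_mul_measure_sublevel_le (μ := volume) (t := 2 * ε) h.isOpen.measurableSet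
      h.measurable h.pos hβ0.le
    rw [h.lintegral_rpow] at h2
    have h3 : ENNReal.ofReal ((2 * ε) ^ (-β)) * (ENNReal.ofReal ((ε / t) ^ n) *
        ENNReal.ofReal K) ≤ 1 := by
      refine le_trans ?_ h2
      rw [hK, ENNReal.ofReal_toReal hVtop]
      rw [finrank_euclideanSpace_fin] at h1
      refine mul_le_mul_right (h1.trans (measure_mono ?_)) _
      rintro x ⟨hx, hxt⟩
      refine ⟨hx, hxt.trans_le ?_⟩
      have : ε / t * t = ε := div_mul_cancel₀ _ ht.ne'
      have : 0 ≤ ε / t * ε := by positivity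
      simp only [ε] at *
      nlinarith
    rw [← ENNReal.ofReal_mul (by positivity), ← ENNReal.ofReal_mul (by positivity),
      ENNReal.ofReal_le_one] at h3
    rw [hδ, Real.rpow_inv_le_iff_of_pos (by positivity) hε.le (by linarith),
      Real.rpow_sub hε, Real.rpow_natCast, div_le_div_iff₀ (by positivity) (by positivity)]
    rw [Real.rpow_neg (by positivity), Real.mul_rpow (by norm_num) hε.le, div_pow,
      inv_mul_le_iff₀ (by positivity), mul_one, div_mul_eq_mul_div,
      div_le_iff₀ (by positivity)] at h3
    linarith
  refine ⟨sInf (φ '' Ω), lt_of_lt_of_le (lt_min hδ0 ht) (le_csInf (h.nonempty.image φ) ?_),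
    isGLB_csInf (h.nonempty.image φ) ⟨min δ t, ?_⟩⟩ <;>
  · rintro _ ⟨x, hx, rfl⟩
    exact hbd x hx

lemma norm_le (h : ConvexRep β f Ω φ) (hβ : 0 ≤ β) (hm0 : 0 < m) (hm : IsGLB (φ '' Ω) m)
    (x : Vec n) : ‖f x‖ ≤ m ^ (-β) := by
  rw [Real.norm_of_nonneg (h.isProbDensity.nonneg x)]
  by_cases hx : x ∈ Ω
  · rw [h.eq_rpow x hx]
    exact Real.rpow_le_rpow_of_nonpos hm0 (hm.1 ⟨x, hx, rfl⟩) (by linarith)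
  · rw [h.eq_zero x hx]
    positivity

lemma memLp_top (h : ConvexRep β f Ω φ) (hβ : 0 ≤ β) (hm0 : 0 < m) (hm : IsGLB (φ '' Ω) m) :
    MemLp f ⊤ volume :=
  memLp_top_of_bound h.isProbDensity.measurable.aestronglyMeasurable (m ^ (-β))
    (Eventually.of_forall (h.norm_le hβ hm0 hm))

lemma supNorm_eq (h : ConvexRep β f Ω φ) (hβ : 0 ≤ β) (hm0 : 0 < m) (hm : IsGLB (φ '' Ω) m) :
    supNorm f = m ^ (-β) := by
  have hmem := h.memLp_top hβ hm0 hm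
  refine le_antisymm ?_ ?_
  · rw [supNorm, eLpNorm_exponent_top]
    exact ENNReal.toReal_le_of_le_ofReal (by positivity)
      (eLpNormEssSup_le_of_ae_bound (Eventually.of_forall (h.norm_le hβ hm0 hm)))
  · -- every sublevel set `{φ < s}` with `s > m` has positive measure
    have hs : ∀ s, m < s → s ^ (-β) ≤ supNorm f := by
      intro s hs
      by_contra! hcon
      obtain ⟨t, hst, ht⟩ := h.exists_sublevel_ne_zero s
      have hr := measure_sublevel_ratio volume h.convexOn hm hs hst.le
      have hr0 : 0 < (s - m) / (t - m) := div_pos (by linarith) (by linarith)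
      have hV : volume {x | x ∈ Ω ∧ φ x < s} ≠ 0 := by
        intro h0
        rw [h0, nonpos_iff_eq_zero, mul_eq_zero] at hr
        rcases hr with hr | hr
        · rw [ENNReal.ofReal_eq_zero] at hr
          exact absurd hr (not_le.2 (pow_pos hr0 _))
        · exact ht hr
      refine hV (measure_mono_null ?_ (ae_iff.1 (ae_le_eLpNormEssSup (f := f) (μ := volume))))
      rintro x ⟨hx, hxs⟩
      simp only [Set.mem_ofPred_eq, not_le]
      rw [← eLpNorm_exponent_top, ← ENNReal.ofReal_toReal hmem.eLpNorm_ne_top,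
        ← ofReal_norm]
      refine (ENNReal.ofReal_lt_ofReal_iff_of_nonneg ENNReal.toReal_nonneg).2 (hcon.trans_le ?_)
      rw [Real.norm_of_nonneg (h.isProbDensity.nonneg x), h.eq_rpow x hx]
      exact Real.rpow_le_rpow_of_nonpos (h.pos x hx) hxs.le (by linarith)
    have hlim : Tendsto (fun s : ℝ => s ^ (-β)) (𝓝[>] m) (𝓝 (m ^ (-β))) :=
      tendsto_nhdsWithin_of_tendsto_nhds
        (Real.continuousAt_rpow_const m (-β) (Or.inl hm0.ne')).tendsto
    exact le_of_tendsto hlim (eventually_mem_nhdsWithin.mono hs)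

lemma integrable (h : ConvexRep β f Ω φ) : Integrable f := by
  refine ⟨h.isProbDensity.measurable.aestronglyMeasurable, ?_⟩
  rw [hasFiniteIntegral_iff_ofReal (Eventually.of_forall h.isProbDensity.nonneg),
    h.isProbDensity.lintegral_eq_one]
  exact ENNReal.one_lt_top

lemma integral_eq_one (h : ConvexRep β f Ω φ) : ∫ x, f x = 1 := by
  rw [integral_eq_lintegral_of_nonneg_ae (Eventually.of_forall h.isProbDensity.nonneg)
    h.isProbDensity.measurable.aestronglyMeasurable, h.isProbDensity.lintegral_eq_one,
    ENNReal.toReal_one]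

/-- The entropy of `f = φ ^ (-β)`, normalized by the supremum norm, is `β` times the mean of the
nonnegative function `log (φ / inf φ)`. -/
lemma entropy_eq (h : ConvexRep β f Ω φ) (hβ : 0 ≤ β) (hm0 : 0 < m) (hm : IsGLB (φ '' Ω) m)
    (hJ : ∫⁻ x in Ω, ENNReal.ofReal (φ x ^ (-β) * Real.log (φ x / m)) ≠ ∞) :
    EntropyFinite f ∧ entropyFun f + Real.log (supNorm f)
      = β * (∫⁻ x in Ω, ENNReal.ofReal (φ x ^ (-β) * Real.log (φ x / m))).toReal := by
  have hnn : ∀ x, 0 ≤ f x * Real.log (φ x / m) := by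
    intro x
    by_cases hx : x ∈ Ω
    · refine mul_nonneg (h.isProbDensity.nonneg x) (Real.log_nonneg ?_)
      rw [one_le_div hm0]
      exact hm.1 ⟨x, hx, rfl⟩
    · rw [h.eq_zero x hx, zero_mul]
  have hmeas : Measurable fun x => f x * Real.log (φ x / m) :=
    h.isProbDensity.measurable.mul (h.measurable.div_const m).log
  have hint : Integrable fun x => f x * Real.log (φ x / m) := by
    refine ⟨hmeas.aestronglyMeasurable, ?_⟩
    rw [hasFiniteIntegral_iff_ofReal (Eventually.of_forall hnn), h.lintegral_mul]
    exact hJ.lt_top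
  have hfun : (fun x => f x * Real.log (f x))
      = fun x => -β * (f x * Real.log (φ x / m)) - β * Real.log m * f x := by
    ext x
    by_cases hx : x ∈ Ω
    · have hp := h.pos x hx
      rw [Real.log_div hp.ne' hm0.ne']
      nth_rewrite 2 [h.eq_rpow x hx]
      rw [Real.log_rpow hp]
      ring
    · simp [h.eq_zero x hx]
  refine ⟨?_, ?_⟩
  · rw [EntropyFinite, hfun]
    exact (hint.const_mul _).sub (h.integrable.const_mul _)
  · rw [entropyFun, hfun, integral_sub (hint.const_mul _) (h.integrable.const_mul _),
      integral_const_mul, integral_const_mul, h.integral_eq_one, h.supNorm_eq hβ hm0 hm,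
      Real.log_rpow hm0, integral_eq_lintegral_of_nonneg_ae (Eventually.of_forall hnn)
        hmeas.aestronglyMeasurable, h.lintegral_mul]
    ring

lemma lintegral_mul_log_le (h : ConvexRep β f Ω φ) (hβ : (n : ℝ) < β) (hm0 : 0 < m)
    (hm : IsGLB (φ '' Ω) m) :
    ∫⁻ x in Ω, ENNReal.ofReal (φ x ^ (-β) * Real.log (φ x / m))
      ≤ ENNReal.ofReal (∑ i ∈ Finset.Icc 1 n, 1 / (β - (i : ℝ))) := by
  have hM : 0 < m ^ β := by positivity
  have hrpow : ∀ x ∈ Ω, (φ x / m) ^ (-β) = m ^ β * φ x ^ (-β) := fun x hx => by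
    rw [Real.div_rpow (h.pos x hx).le hm0.le, Real.rpow_neg hm0.le, div_inv_eq_mul, mul_comm]
  have hgl : IsGLB ((fun x => φ x / m) '' Ω) 1 := by
    constructor
    · rintro _ ⟨x, hx, rfl⟩
      exact (one_le_div hm0).2 (hm.1 ⟨x, hx, rfl⟩)
    · intro b hb
      have : b * m ≤ m := hm.2 <| by
        rintro _ ⟨x, hx, rfl⟩
        exact (le_div_iff₀ hm0).1 (hb ⟨x, hx, rfl⟩)
      exact le_of_mul_le_mul_right (by linarith) hm0
  have hconv : ConvexOn ℝ Ω fun x => φ x / m := by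
    refine (h.convexOn.smul (inv_nonneg.2 hm0.le)).congr fun x _ => ?_
    simp only [smul_eq_mul]
    rw [inv_mul_eq_div]
  have e1 : ∫⁻ x in Ω, ENNReal.ofReal ((φ x / m) ^ (-β)) = ENNReal.ofReal (m ^ β) := by
    rw [setLIntegral_congr_fun h.isOpen.measurableSet
      (g := fun x => ENNReal.ofReal (m ^ β) * ENNReal.ofReal (φ x ^ (-β))) fun x hx => by
        simp only [hrpow x hx]; exact ENNReal.ofReal_mul hM.le,
      lintegral_const_mul' _ _ ENNReal.ofReal_ne_top, h.lintegral_rpow, mul_one]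
  have e2 : ∫⁻ x in Ω, ENNReal.ofReal ((φ x / m) ^ (-β) * Real.log (φ x / m))
      = ENNReal.ofReal (m ^ β) *
        ∫⁻ x in Ω, ENNReal.ofReal (φ x ^ (-β) * Real.log (φ x / m)) := by
    rw [← lintegral_const_mul' _ _ ENNReal.ofReal_ne_top]
    refine setLIntegral_congr_fun h.isOpen.measurableSet fun x hx => ?_
    simp only [hrpow x hx]
    rw [← ENNReal.ofReal_mul hM.le, mul_assoc]
  have key := lintegral_rpow_neg_mul_log_le hβ h.isOpen.measurableSet hconv
    (h.measurable.div_const m) hgl (by rw [e1]; exact ENNReal.ofReal_ne_top)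
  rw [e1, e2, mul_comm] at key
  exact (ENNReal.mul_le_mul_iff_left (by simpa using hM) ENNReal.ofReal_ne_top).1 key

lemma entropy_bound (h : ConvexRep β f Ω φ) (hβ : (n : ℝ) < β) :
    MemLp f ⊤ volume ∧ 0 < supNorm f ∧ EntropyFinite f ∧
      entropyFun f + Real.log (supNorm f) ≤ β * ∑ i ∈ Finset.Icc 1 n, 1 / (β - (i : ℝ)) := by
  have hβ0 : 0 < β := lt_of_le_of_lt (Nat.cast_nonneg n) hβ
  obtain ⟨m, hm0, hm⟩ := h.exists_isGLB hβ
  have hle := h.lintegral_mul_log_le hβ hm0 hm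
  obtain ⟨h1, h2⟩ := h.entropy_eq hβ0.le hm0 hm (ne_top_of_le_ne_top ENNReal.ofReal_ne_top hle)
  refine ⟨h.memLp_top hβ0.le hm0 hm, ?_, h1, ?_⟩
  · rw [h.supNorm_eq hβ0.le hm0 hm]; positivity
  · rw [h2]
    exact mul_le_mul_of_nonneg_left
      (ENNReal.toReal_le_of_le_ofReal (sum_one_div_sub_nonneg hβ) hle) hβ0.le

end ConvexRep

/-! ### The Pareto density -/

section Pareto

variable {n : ℕ} {β a : ℝ}

lemma le_add_sum_of_mem_posOrthant {x : Vec n} (hx : x ∈ posOrthant n) : a ≤ a + ∑ i, x i :=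
  le_add_of_nonneg_right (Finset.sum_nonneg fun i _ => (hx i).le)

lemma lintegral_posOrthant_rpow (hβ : (n : ℝ) < β) (ha : 0 < a) :
    ∫⁻ x in posOrthant n, ENNReal.ofReal ((a + ∑ i, x i) ^ (-β))
      = ENNReal.ofReal (a ^ (n - β) / ∏ i ∈ Finset.Icc 1 n, (β - (i : ℝ))) := by
  simpa using lintegral_posOrthant_rpow_mul_log (n := n) (e := 0) (d := 1) ha le_rfl hβ
    le_rfl zero_le_one

lemma paretoZ_eq (hβ : (n : ℝ) < β) (ha : 0 < a) :
    paretoZ n β a = a ^ (n - β) / ∏ i ∈ Finset.Icc 1 n, (β - (i : ℝ)) := by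
  have hP := prod_sub_pos hβ
  rw [paretoZ, integral_eq_lintegral_of_nonneg_ae _ (Measurable.aestronglyMeasurable (by fun_prop)),
    lintegral_posOrthant_rpow hβ ha, ENNReal.toReal_ofReal (by positivity)]
  refine (ae_restrict_iff' (measurableSet_posOrthant n)).2 (Eventually.of_forall fun x hx => ?_)
  exact Real.rpow_nonneg (ha.le.trans (le_add_sum_of_mem_posOrthant hx)) _

lemma paretoZ_pos (hβ : (n : ℝ) < β) (ha : 0 < a) : 0 < paretoZ n β a := by
  rw [paretoZ_eq hβ ha]
  exact div_pos (by positivity) (prod_sub_pos hβ)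

/-- The Pareto density in the form `φ ^ (-β)`: the normalizing factor is absorbed into `φ`. -/
lemma convexRep_pareto (hβ : (n : ℝ) < β) (ha : 0 < a) :
    ConvexRep β (pareto n β a) (posOrthant n)
      (fun x => paretoZ n β a ^ β⁻¹ * (a + ∑ i, x i)) := by
  have hβ0 : 0 < β := lt_of_le_of_lt (Nat.cast_nonneg n) hβ
  have hZ := paretoZ_pos hβ ha
  have hO := measurableSet_posOrthant n
  have hpos : ∀ x ∈ posOrthant n, 0 < a + ∑ i, x i := fun x hx =>
    ha.trans_le (le_add_sum_of_mem_posOrthant hx)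
  refine ⟨⟨Measurable.indicator (by fun_prop) hO, ?_, ?_⟩, isOpen_posOrthant n, ?_, by fun_prop, ?_,
    ?_, fun x hx => Set.indicator_of_notMem hx _⟩
  · exact Set.indicator_nonneg fun x hx => by have := hpos x hx; positivity
  · have e : ∀ x, ENNReal.ofReal (pareto n β a x) = (posOrthant n).indicator (fun x =>
        ENNReal.ofReal (1 / paretoZ n β a) * ENNReal.ofReal ((a + ∑ i, x i) ^ (-β))) x := by
      intro x
      by_cases hx : x ∈ posOrthant n
      · rw [pareto, Set.indicator_of_mem hx, Set.indicator_of_mem hx,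
          ENNReal.ofReal_mul (by positivity)]
      · rw [pareto, Set.indicator_of_notMem hx, Set.indicator_of_notMem hx, ENNReal.ofReal_zero]
    rw [lintegral_congr e, lintegral_indicator hO, lintegral_const_mul _ (by fun_prop),
      lintegral_posOrthant_rpow hβ ha, ← paretoZ_eq hβ ha, ← ENNReal.ofReal_mul (by positivity),
      one_div_mul_cancel hZ.ne', ENNReal.ofReal_one]
  · have hc : Convex ℝ (posOrthant n) := by
      intro x hx y hy s t hs ht hst i
      simp only [PiLp.add_apply, PiLp.smul_apply, smul_eq_mul]
      have hx' := hx i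
      have hy' := hy i
      rcases hs.eq_or_lt with rfl | hs'
      · have : t = 1 := by linarith
        subst this
        simpa using hy'
      · exact add_pos_of_pos_of_nonneg (mul_pos hs' hx') (mul_nonneg ht hy'.le)
    refine ⟨hc, fun x _ y _ s t _ _ hst => le_of_eq ?_⟩
    simp only [PiLp.add_apply, PiLp.smul_apply, smul_eq_mul, Finset.sum_add_distrib,
      ← Finset.mul_sum]
    linear_combination (-(paretoZ n β a ^ β⁻¹ * a)) * hst
  · intro x hx
    have := hpos x hx
    positivity
  · intro x hx
    have := hpos x hx
    rw [pareto, Set.indicator_of_mem hx, Real.mul_rpow (by positivity) this.le, ← Real.rpow_mul hZ.le,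
      mul_neg, inv_mul_cancel₀ hβ0.ne', Real.rpow_neg_one, one_div]

lemma isGLB_pareto (hβ : (n : ℝ) < β) (ha : 0 < a) :
    IsGLB ((fun x : Vec n => paretoZ n β a ^ β⁻¹ * (a + ∑ i, x i)) '' posOrthant n)
      (paretoZ n β a ^ β⁻¹ * a) := by
  have hZ := paretoZ_pos hβ ha
  constructor
  · rintro _ ⟨x, hx, rfl⟩
    exact mul_le_mul_of_nonneg_left (le_add_sum_of_mem_posOrthant hx) (by positivity)
  · intro b hb
    -- approach the corner of the orthant along the diagonal
    have hlim : Tendsto (fun ε : ℝ => paretoZ n β a ^ β⁻¹ * (a + n * ε)) (𝓝[>] 0)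
        (𝓝 (paretoZ n β a ^ β⁻¹ * a)) := by
      have : Continuous fun ε : ℝ => paretoZ n β a ^ β⁻¹ * (a + n * ε) := by fun_prop
      simpa using (this.tendsto 0).mono_left nhdsWithin_le_nhds
    refine ge_of_tendsto hlim (eventually_mem_nhdsWithin.mono fun ε hε => ?_)
    have := hb ⟨WithLp.toLp 2 fun _ => ε, fun i => hε, rfl⟩
    simpa using this

lemma supNorm_pareto (hβ : (n : ℝ) < β) (ha : 0 < a) :
    supNorm (pareto n β a) = (∏ i ∈ Finset.Icc 1 n, (β - (i : ℝ))) / a ^ n := by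
  have hβ0 : 0 < β := lt_of_le_of_lt (Nat.cast_nonneg n) hβ
  have hZ := paretoZ_pos hβ ha
  rw [(convexRep_pareto hβ ha).supNorm_eq hβ0.le (by positivity) (isGLB_pareto hβ ha),
    Real.mul_rpow (by positivity) ha.le, ← Real.rpow_mul hZ.le, mul_neg, inv_mul_cancel₀ hβ0.ne',
    Real.rpow_neg_one, paretoZ_eq hβ ha, Real.rpow_sub ha, Real.rpow_natCast, Real.rpow_neg ha.le]
  have := prod_sub_pos hβ
  have : a ^ β ≠ 0 := by positivity
  field_simp

lemma entropyFun_pareto (hβ : (n : ℝ) < β) (ha : 0 < a) :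
    entropyFun (pareto n β a) + Real.log (supNorm (pareto n β a))
      = β * ∑ i ∈ Finset.Icc 1 n, 1 / (β - (i : ℝ)) := by
  have hβ0 : 0 < β := lt_of_le_of_lt (Nat.cast_nonneg n) hβ
  have hZ := paretoZ_pos hβ ha
  have hc := sum_one_div_sub_nonneg hβ
  have hJ : ∫⁻ x in posOrthant n, ENNReal.ofReal ((paretoZ n β a ^ β⁻¹ * (a + ∑ i, x i)) ^ (-β) *
      Real.log ((paretoZ n β a ^ β⁻¹ * (a + ∑ i, x i)) / (paretoZ n β a ^ β⁻¹ * a)))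
      = ENNReal.ofReal (∑ i ∈ Finset.Icc 1 n, 1 / (β - (i : ℝ))) := by
    have e : ∀ x ∈ posOrthant n, ENNReal.ofReal ((paretoZ n β a ^ β⁻¹ * (a + ∑ i, x i)) ^ (-β) *
        Real.log ((paretoZ n β a ^ β⁻¹ * (a + ∑ i, x i)) / (paretoZ n β a ^ β⁻¹ * a)))
        = ENNReal.ofReal (1 / paretoZ n β a) * ENNReal.ofReal
          ((a + ∑ i, x i) ^ (-β) * (1 * Real.log ((a + ∑ i, x i) / a) + 0)) := by
      intro x hx
      have hx0 : 0 < a + ∑ i, x i := ha.trans_le (le_add_sum_of_mem_posOrthant hx)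
      rw [← ENNReal.ofReal_mul (by positivity), mul_div_mul_left _ _ (by positivity),
        Real.mul_rpow (by positivity) hx0.le, ← Real.rpow_mul hZ.le, mul_neg,
        inv_mul_cancel₀ hβ0.ne', Real.rpow_neg_one, one_div]
      congr 1
      ring
    rw [setLIntegral_congr_fun (measurableSet_posOrthant n) e,
      lintegral_const_mul' _ _ ENNReal.ofReal_ne_top,
      lintegral_posOrthant_rpow_mul_log ha le_rfl hβ zero_le_one le_rfl, ← paretoZ_eq hβ ha,
      ← ENNReal.ofReal_mul (by positivity), ← mul_assoc, one_div_mul_cancel hZ.ne', div_self ha.ne',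
      Real.log_one]
    simp
  rw [((convexRep_pareto hβ ha).entropy_eq hβ0.le (by positivity) (isGLB_pareto hβ ha)
    (by rw [hJ]; exact ENNReal.ofReal_ne_top)).2, hJ, ENNReal.toReal_ofReal hc]

end Pareto

lemma HasDensity.entropy_eq {n : ℕ} {S : Type*} [MeasurableSpace S] {X : S → Vec n}
    {P : Measure S} {f : Vec n → ℝ} (h : HasDensity X P f) : entropy X P = entropyFun f := by
  have hpdf : pdf X P volume =ᵐ[volume] fun x => ENNReal.ofReal (f x) := by
    rw [pdf, h.map_eq]
    exact Measure.rnDeriv_withDensity _ h.isProbDensity.measurable.ennreal_ofReal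
  rw [entropy, entropyFun, entropyFun]
  congr 1
  refine integral_congr_ae ?_
  filter_upwards [hpdf] with x hx
  rw [hx, ENNReal.toReal_ofReal (h.isProbDensity.nonneg x)]

end ConvexEntropy

end

theorem theorem3 (n : ℕ) (hn : 1 ≤ n) (β : ℝ) (hβ : (n : ℝ) + 1 ≤ β) :
    -- the Pareto densities belong to the class and attain the bound
    (∀ a : ℝ, 0 < a →
      ConvexEntropy.IsProbDensity (ConvexEntropy.pareto n β a) ∧
      ConvexEntropy.IsConvexForm β (ConvexEntropy.pareto n β a) ∧
      MemLp (ConvexEntropy.pareto n β a) ⊤ volume ∧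
      0 < ConvexEntropy.supNorm (ConvexEntropy.pareto n β a) ∧
      ConvexEntropy.EntropyFinite (ConvexEntropy.pareto n β a) ∧
      ConvexEntropy.entropyFun (ConvexEntropy.pareto n β a)
          + Real.log (ConvexEntropy.supNorm (ConvexEntropy.pareto n β a))
        = β * ∑ i ∈ Finset.Icc 1 n, 1 / (β - (i : ℝ))) ∧
    -- every prescribed value of the norm is the norm of a Pareto density
    (∀ M : ℝ, 0 < M →
      ∃ a : ℝ, 0 < a ∧ ConvexEntropy.supNorm (ConvexEntropy.pareto n β a) = M) ∧
    -- the Pareto distribution maximizes the entropy for a fixed norm, and the explicit bound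
    (∀ (S : Type*) [MeasurableSpace S] (P : Measure S) [IsProbabilityMeasure P]
      (X : S → ConvexEntropy.Vec n) (f : ConvexEntropy.Vec n → ℝ),
      ConvexEntropy.HasDensity X P f → ConvexEntropy.IsConvexForm β f →
      MemLp f ⊤ volume ∧
      0 < ConvexEntropy.supNorm f ∧
      ConvexEntropy.EntropyFinite f ∧
      (∀ a : ℝ, 0 < a →
        ConvexEntropy.supNorm (ConvexEntropy.pareto n β a) = ConvexEntropy.supNorm f →
        ConvexEntropy.entropy X P ≤ ConvexEntropy.entropyFun (ConvexEntropy.pareto n β a)) ∧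
      ConvexEntropy.entropy X P + Real.log (ConvexEntropy.supNorm f)
        ≤ β * ∑ i ∈ Finset.Icc 1 n, 1 / (β - (i : ℝ))) := by
  have hβ' : (n : ℝ) < β := by linarith
  refine ⟨fun a ha => ?_, fun M hM => ?_, ?_⟩
  · have h := ConvexEntropy.convexRep_pareto hβ' ha
    obtain ⟨h1, h2, h3, -⟩ := h.entropy_bound hβ'
    exact ⟨h.isProbDensity, ⟨_, _, h.isOpen, h.convexOn.1, h.convexOn, h.pos, h.eq_rpow, h.eq_zero⟩,
      h1, h2, h3, ConvexEntropy.entropyFun_pareto hβ' ha⟩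
  · have hP := ConvexEntropy.prod_sub_pos hβ'
    refine ⟨((∏ i ∈ Finset.Icc 1 n, (β - (i : ℝ))) / M) ^ (n : ℝ)⁻¹, by positivity, ?_⟩
    rw [ConvexEntropy.supNorm_pareto hβ' (by positivity),
      Real.rpow_inv_natCast_pow (by positivity) (by omega), div_div_cancel₀ hP.ne']
  · intro S _ P _ X f hX hf
    obtain ⟨Ω, φ, h⟩ := hf.exists_convexRep
      (lt_of_le_of_lt (Nat.cast_nonneg n) hβ') hX.isProbDensity
    obtain ⟨h1, h2, h3, h4⟩ := h.entropy_bound hβ'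
    rw [hX.entropy_eq]
    refine ⟨h1, h2, h3, fun a ha hsup => ?_, h4⟩
    have := ConvexEntropy.entropyFun_pareto hβ' ha
    rw [hsup] at this
    linarith
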